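/- Let $\rho$ and $\sigma$ be positive definite operators on a finite-dimensional complex Hilbert space, with $\operatorname{tr}\rho = 1$. Let $D(\rho\|\sigma) = \operatorname{tr}[\rho(\log\rho-\log\sigma)]$ be Umegaki's relative entropy, and let the measured relative entropy be $$D^{\mathbb{M}}(\rho\|\sigma) = \sup_{(\mathcal{X},M)} \sum_{x\in\mathcal{X}} \operatorname{tr}[M(x)\rho]\,\log\frac{\operatorname{tr}[M(x)\rho]}{\operatorname{tr}[M(x)\sigma]},$$ where the supremum is over all finite sets $\mathcal{X}$ and all positive operator valued measures $M$ on $\mathcal{X}$ (maps from $\mathcal{X}$ to positive semidefinite operators with $\sum_{x\in\mathcal{X}} M(x) = 1$), $\log$ is the natural logarithm, and a summand with $\operatorname{tr}[M(x)\rho]=0$ is zero. Then $$D^{\mathbb{M}}(\rho\|\sigma) \le D(\rho\|\sigma),$$ with equality if and only if $[\rho,\sigma]=0$. -/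

import Mathlib

open scoped Matrix ComplexOrder

noncomputable section

namespace QuantumEntropy

/-- The Kullback-Leibler divergence `∑ x, P x * log (P x / Q x)` of measures `P`, `Q` on a finite
set, given by their point masses. It is `⊤` if `P` is not absolutely continuous with respect to `Q`.
A summand with `P x = 0` is zero. As `Q` need not be normalised, the value may be negative. -/
def klDivergence {X : Type*} [Fintype X] (P Q : X → ℝ) : EReal :=
  open Classical in
  if ∀ x, Q x = 0 → P x = 0 then ((∑ x, P x * Real.log (P x / Q x) : ℝ) : EReal) else ⊤

variable {n : Type*} [Fintype n] [DecidableEq n]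

/-- A positive operator valued measure on the finite set `X`. -/
structure POVM (X : Type*) [Fintype X] (n : Type*) [Fintype n] [DecidableEq n] where
  /-- The positive semidefinite operator attached to an outcome. -/
  effect : X → Matrix n n ℂ
  posSemidef : ∀ x, (effect x).PosSemidef
  sum_eq_one : ∑ x, effect x = 1

/-- The measure `x ↦ tr (M x * ρ)` on the set of outcomes (the trace is real, and nonnegative, if
`ρ` is positive semidefinite). -/
def POVM.statistics {X : Type*} [Fintype X] (M : POVM X n) (ρ : Matrix n n ℂ) (x : X) : ℝ :=
  (Matrix.trace (M.effect x * ρ)).re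

/-- The measured relative entropy: the supremum of the Kullback-Leibler divergences of the
measurement statistics over all finite sets of outcomes and all POVMs on them. -/
def measuredRelEntropy (ρ σ : Matrix n n ℂ) : EReal :=
  ⨆ (X : Type) (_ : Fintype X) (M : POVM X n), klDivergence (M.statistics ρ) (M.statistics σ)

/-- Umegaki's relative entropy `tr (ρ (log ρ - log σ))` if the support of `ρ` is contained in the
support of `σ` (that is, the kernel of `σ` in the kernel of `ρ`), and `⊤` otherwise. The logarithm
of a positive semidefinite matrix is taken on its support, since `Real.log 0 = 0`. -/
def umegakiRelEntropy (ρ σ : Matrix n n ℂ) : EReal :=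
  open Classical in
  if ∀ v : n → ℂ, σ *ᵥ v = 0 → ρ *ᵥ v = 0 then
    (((Matrix.trace (ρ * (cfc Real.log ρ - cfc Real.log σ))).re : ℝ) : EReal)
  else ⊤

end QuantumEntropy

end

/-! Write `a log (a/b)` as the integral over `s` in `[0,1]` of `a (a - b) / w`, where `w = (1 - s) b
+ s a`. Up to the factor `1 - s` and the subtraction of `a`, the integrand is `a² / w`, the maximum
over `z` of `2 a z - w z²`. Inserting the classical maximizers `z x` into `Z = ∑ x, z x • M x`,
Kadison's inequality bounds the classical maximum by `2 re tr (ρ Z) - (1 - s) tr (σ Z²) - s tr (ρ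
Z²)`. The maximum of the corresponding form over all matrices, attained at `G s = optimizer U V p q
s`, gives the integrand of Umegaki's entropy. This yields the inequality (`sum_logKernel_add_le`).

For strictness: `Z` is Hermitian, so the loss is at least a multiple of the squared non-Hermitian
part of `G s`, whatever the measurement. The gap therefore survives the supremum, which need not be
known to be attained. Since `G 0 * σ = ρ`, a Hermitian `G 0` would make `ρ` and `σ` commute;
otherwise continuity in `s` makes the integrated gap positive (`exists_measuredRelEntropy_le`). If
the states commute, their joint spectral measurement attains Umegaki's value. -/

open Matrix in
/-- The functional calculus of a Hermitian matrix in terms of its eigenvector unitary. -/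
theorem Matrix.IsHermitian.cfc_eq_mul_diagonal_mul {n : Type*} [Fintype n] [DecidableEq n]
    {A : Matrix n n ℂ} (hA : A.IsHermitian) (f : ℝ → ℝ) :
    cfc f A = (hA.eigenvectorUnitary : Matrix n n ℂ) *
      diagonal (fun i => (f (hA.eigenvalues i) : ℂ)) *
        (hA.eigenvectorUnitary : Matrix n n ℂ)ᴴ := by
  rw [hA.cfc_eq, Matrix.IsHermitian.cfc, Unitary.conjStarAlgAut_apply]
  rfl

open Matrix in
theorem Matrix.IsHermitian.eq_mul_diagonal_mul {n : Type*} [Fintype n] [DecidableEq n]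
    {A : Matrix n n ℂ} (hA : A.IsHermitian) :
    A = (hA.eigenvectorUnitary : Matrix n n ℂ) *
      diagonal (fun i => (hA.eigenvalues i : ℂ)) *
        (hA.eigenvectorUnitary : Matrix n n ℂ)ᴴ := by
  conv_lhs => rw [hA.spectral_theorem, Unitary.conjStarAlgAut_apply]
  rfl

namespace QuantumEntropy

open Matrix

variable {n : Type*} [Fintype n] [DecidableEq n]

/-! ### Traces in a pair of eigenbases -/

theorem re_trace_conj_mul (U V Z : Matrix n n ℂ) (hV : V * Vᴴ = 1) (p : n → ℝ) :
    (trace (U * diagonal (fun i => (p i : ℂ)) * Uᴴ * Z)).re =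
      ∑ i, ∑ j, p i * ((Uᴴ * Z * V) i j * star ((Uᴴ * V) i j)).re := by
  have h : trace (U * diagonal (fun i => (p i : ℂ)) * Uᴴ * Z) =
      trace (diagonal (fun i => (p i : ℂ)) * ((Uᴴ * Z * V) * (Uᴴ * V)ᴴ)) := by
    have : (Uᴴ * Z * V) * (Uᴴ * V)ᴴ = Uᴴ * Z * (V * Vᴴ) * U := by
      simp [Matrix.mul_assoc]
    rw [this, hV, Matrix.mul_one, Matrix.mul_assoc U, Matrix.mul_assoc U, trace_mul_comm U]
    simp only [Matrix.mul_assoc]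
  rw [h]
  simp only [trace, diag_apply, diagonal_mul, Complex.re_sum, Complex.re_ofReal_mul,
    mul_apply (M := Uᴴ * Z * V), conjTranspose_apply, Finset.mul_sum]

/-- The mixed matrix elements `Uᴴ * Z * V` turn both quadratic terms into weighted sums of squares:
`ρ` weights the rows and `σ` the columns, so no common eigenbasis is needed. -/
theorem re_trace_conj_mul_sq_left (U V Z : Matrix n n ℂ) (hV : V * Vᴴ = 1) (hZ : Z.IsHermitian)
    (p : n → ℝ) :
    (trace (U * diagonal (fun i => (p i : ℂ)) * Uᴴ * (Z * Z))).re =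
      ∑ i, ∑ j, p i * Complex.normSq ((Uᴴ * Z * V) i j) := by
  have h : trace (U * diagonal (fun i => (p i : ℂ)) * Uᴴ * (Z * Z)) =
      trace (diagonal (fun i => (p i : ℂ)) * ((Uᴴ * Z * V) * (Uᴴ * Z * V)ᴴ)) := by
    have : (Uᴴ * Z * V) * (Uᴴ * Z * V)ᴴ = Uᴴ * Z * (V * Vᴴ) * Z * U := by
      simp [Matrix.mul_assoc, hZ.eq]
    rw [this, hV, Matrix.mul_one, Matrix.mul_assoc U, Matrix.mul_assoc U, trace_mul_comm U]
    simp only [Matrix.mul_assoc]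
  rw [h]
  simp only [trace, diag_apply, diagonal_mul, Complex.re_sum,
    mul_apply (M := Uᴴ * Z * V), conjTranspose_apply, Finset.mul_sum, Complex.star_def,
    Complex.mul_conj, ← Complex.ofReal_mul, Complex.ofReal_re]

theorem re_trace_conj_mul_sq_right (U V Z : Matrix n n ℂ) (hU : U * Uᴴ = 1) (hZ : Z.IsHermitian)
    (q : n → ℝ) :
    (trace (V * diagonal (fun i => (q i : ℂ)) * Vᴴ * (Z * Z))).re =
      ∑ i, ∑ j, q j * Complex.normSq ((Uᴴ * Z * V) i j) := by
  rw [re_trace_conj_mul_sq_left V U Z hU hZ, Finset.sum_comm]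
  refine Finset.sum_congr rfl fun i _ => Finset.sum_congr rfl fun j _ => ?_
  have : Vᴴ * Z * U = (Uᴴ * Z * V)ᴴ := by simp [Matrix.mul_assoc, hZ.eq]
  rw [this, conjTranspose_apply, Complex.star_def, Complex.normSq_conj]

theorem re_trace_conj_mul_conj (U V : Matrix n n ℂ) (hV : V * Vᴴ = 1) (hV' : Vᴴ * V = 1)
    (p q : n → ℝ) :
    (trace (U * diagonal (fun i => (p i : ℂ)) * Uᴴ *
      (V * diagonal (fun i => (q i : ℂ)) * Vᴴ))).re =
      ∑ i, ∑ j, Complex.normSq ((Uᴴ * V) i j) * (p i * q j) := by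
  rw [re_trace_conj_mul _ V _ hV]
  refine Finset.sum_congr rfl fun i _ => Finset.sum_congr rfl fun j _ => ?_
  have : Uᴴ * (V * diagonal (fun i => (q i : ℂ)) * Vᴴ) * V =
      (Uᴴ * V) * diagonal (fun i => (q i : ℂ)) := by
    simp only [Matrix.mul_assoc, hV', Matrix.mul_one]
  rw [this, mul_diagonal, mul_right_comm, Complex.star_def, Complex.mul_conj, ← Complex.ofReal_mul,
    Complex.ofReal_re]
  ring

/-- The squared Frobenius norm is unitarily invariant. -/
theorem sum_normSq_conj (U V A : Matrix n n ℂ) (hU : U * Uᴴ = 1) (hV : V * Vᴴ = 1) :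
    ∑ i, ∑ j, Complex.normSq ((Uᴴ * A * V) i j) = ∑ i, ∑ j, Complex.normSq (A i j) := by
  have key : ∀ B : Matrix n n ℂ,
      ∑ i, ∑ j, Complex.normSq (B i j) = (trace (B * Bᴴ)).re := by
    intro B
    simp only [trace, diag_apply, Complex.re_sum, mul_apply, conjTranspose_apply,
      Complex.star_def, Complex.mul_conj, Complex.ofReal_re]
  rw [key, key]
  have : (Uᴴ * A * V) * (Uᴴ * A * V)ᴴ = Uᴴ * (A * (V * Vᴴ) * Aᴴ * U) := by
    simp [Matrix.mul_assoc]
  rw [this, hV, trace_mul_comm]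
  simp [Matrix.mul_assoc, hU]

open scoped MatrixOrder in
theorem exists_eq_conjTranspose_mul_self {A : Matrix n n ℂ} (hA : A.PosSemidef) :
    ∃ C : Matrix n n ℂ, A = Cᴴ * C :=
  CStarAlgebra.nonneg_iff_eq_star_mul_self.mp hA.nonneg

theorem re_trace_mul_nonneg {A B : Matrix n n ℂ} (hA : A.PosSemidef) (hB : B.PosSemidef) :
    0 ≤ (trace (A * B)).re := by
  obtain ⟨C, rfl⟩ := exists_eq_conjTranspose_mul_self hA
  rw [Matrix.mul_assoc, trace_mul_comm]
  exact (Complex.nonneg_iff.mp (hB.mul_mul_conjTranspose_same C).trace_nonneg).1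

/-! ### Measurements and Kadison's inequality -/

section POVM

variable {X : Type*} [Fintype X] (M : POVM X n)

/-- The operator `∑ x, z x • M x`. -/
noncomputable def POVM.operator (z : X → ℝ) : Matrix n n ℂ := ∑ x, (z x : ℂ) • M.effect x

theorem POVM.isHermitian_operator (z : X → ℝ) : (M.operator z).IsHermitian := by
  rw [IsHermitian, POVM.operator, conjTranspose_sum]
  refine Finset.sum_congr rfl fun x _ => ?_
  rw [conjTranspose_smul, (M.posSemidef x).1.eq, Complex.star_def, Complex.conj_ofReal]

theorem POVM.statistics_nonneg {ρ : Matrix n n ℂ} (hρ : ρ.PosSemidef) (x : X) :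
    0 ≤ M.statistics ρ x :=
  re_trace_mul_nonneg (M.posSemidef x) hρ

theorem POVM.sum_statistics (ρ : Matrix n n ℂ) : ∑ x, M.statistics ρ x = ρ.trace.re := by
  simp only [POVM.statistics]
  rw [← Complex.re_sum, ← trace_sum, ← Matrix.sum_mul, M.sum_eq_one, Matrix.one_mul]

theorem POVM.re_trace_mul_operator (ρ : Matrix n n ℂ) (z : X → ℝ) :
    (trace (ρ * M.operator z)).re = ∑ x, z x * M.statistics ρ x := by
  rw [trace_mul_comm, POVM.operator, Matrix.sum_mul, trace_sum, Complex.re_sum]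
  refine Finset.sum_congr rfl fun x _ => ?_
  rw [Matrix.smul_mul, trace_smul, smul_eq_mul, Complex.re_ofReal_mul, POVM.statistics]

/-- Kadison's inequality for the unital positive map `z ↦ ∑ x, z x • M x`. -/
theorem POVM.posSemidef_operator_sq (z : X → ℝ) :
    (M.operator (fun x => z x ^ 2) - M.operator z * M.operator z).PosSemidef := by
  -- An operator-valued variance: the mean of the squared deviations from `M.operator z`.
  have h : M.operator (fun x => z x ^ 2) - M.operator z * M.operator z =
      ∑ x, ((z x : ℂ) • 1 - M.operator z) * M.effect x * ((z x : ℂ) • 1 - M.operator z)ᴴ := by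
    have h2 : ∀ x, ((z x : ℂ) • 1 - M.operator z)ᴴ = (z x : ℂ) • 1 - M.operator z := by
      intro x
      simp [conjTranspose_smul, (M.isHermitian_operator z).eq]
    have h3 : ∀ x, ((z x : ℂ) • 1 - M.operator z) * M.effect x * ((z x : ℂ) • 1 - M.operator z) =
        ((z x ^ 2 : ℝ) : ℂ) • M.effect x - ((z x : ℂ) • M.effect x) * M.operator z
          - M.operator z * ((z x : ℂ) • M.effect x)
          + M.operator z * M.effect x * M.operator z := by
      intro x
      simp only [sub_mul, mul_sub, smul_mul_assoc, mul_smul_comm, one_mul, mul_one, smul_sub,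
        smul_smul]
      push_cast
      rw [pow_two]
      abel
    simp only [h2, h3]
    rw [Finset.sum_add_distrib, Finset.sum_sub_distrib, Finset.sum_sub_distrib,
      ← Finset.sum_mul, ← Finset.mul_sum, ← Finset.sum_mul, ← Finset.mul_sum, M.sum_eq_one, mul_one]
    change _ = M.operator _ - M.operator z * M.operator z - M.operator z * M.operator z + _
    abel
  rw [h]
  exact posSemidef_sum _ fun x _ => (M.posSemidef x).mul_mul_conjTranspose_same _

theorem POVM.re_trace_mul_operator_sq_le {ρ : Matrix n n ℂ} (hρ : ρ.PosSemidef) (z : X → ℝ) :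
    (trace (ρ * (M.operator z * M.operator z))).re ≤ ∑ x, z x ^ 2 * M.statistics ρ x := by
  have h := re_trace_mul_nonneg hρ (M.posSemidef_operator_sq z)
  rw [mul_sub, trace_sub, Complex.sub_re, M.re_trace_mul_operator] at h
  linarith

/-- The statistics of an outcome vanishes in a positive definite state only if the effect does. -/
theorem POVM.effect_eq_zero {σ : Matrix n n ℂ} (hσ : σ.PosDef) {x : X}
    (h : M.statistics σ x = 0) : M.effect x = 0 := by
  obtain ⟨C, hC⟩ := exists_eq_conjTranspose_mul_self (M.posSemidef x)
  have hps := hσ.posSemidef.mul_mul_conjTranspose_same C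
  rw [POVM.statistics, hC, Matrix.mul_assoc, trace_mul_comm] at h
  -- A positive semidefinite matrix with zero trace vanishes; the imaginary part of the trace is
  -- zero by positivity.
  have h0 : C * σ * Cᴴ = 0 := by
    rw [← hps.trace_eq_zero_iff]
    exact Complex.ext h (Complex.nonneg_iff.mp hps.trace_nonneg).2.symm
  obtain ⟨S, hS⟩ := exists_eq_conjTranspose_mul_self hσ.posSemidef
  have h1 : C * Sᴴ = 0 := by
    rw [← self_mul_conjTranspose_eq_zero]
    simpa [hS, Matrix.mul_assoc] using h0
  have h2 : C = 0 := by
    refine (hσ.isUnit.mul_left_eq_zero).mp ?_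
    rw [hS, ← Matrix.mul_assoc, h1, Matrix.zero_mul]
  rw [hC, h2, mul_zero]

theorem POVM.statistics_eq_zero {σ : Matrix n n ℂ} (hσ : σ.PosDef) {x : X}
    (h : M.statistics σ x = 0) (ρ : Matrix n n ℂ) : M.statistics ρ x = 0 := by
  rw [POVM.statistics, M.effect_eq_zero hσ h, Matrix.zero_mul, trace_zero, Complex.zero_re]

end POVM

/-! ### Integral representation of the logarithm -/

/-- The integrand in `a * log (a / b) = ∫ s in 0..1, a * (a - b) / ((1 - s) * b + s * a)`. -/
noncomputable def logKernel (a b s : ℝ) : ℝ := a * (a - b) / ((1 - s) * b + s * a)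

theorem convexCombination_pos {a b s : ℝ} (ha : 0 < a) (hb : 0 < b) (hs : s ∈ Set.Icc (0 : ℝ) 1) :
    0 < (1 - s) * b + s * a := by
  rcases eq_or_lt_of_le hs.1 with h | h
  · simp [← h, hb]
  · have := mul_pos h ha
    have := mul_nonneg (sub_nonneg.mpr hs.2) hb.le
    linarith

theorem continuousOn_logKernel {a b : ℝ} (ha : 0 ≤ a) (hb : 0 ≤ b) (hab : b = 0 → a = 0) :
    ContinuousOn (logKernel a b) (Set.Icc 0 1) := by
  rcases eq_or_lt_of_le ha with rfl | ha
  · have : logKernel 0 b = fun _ => 0 := by ext; simp [logKernel]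
    rw [this]
    exact continuousOn_const
  have hb : 0 < b := lt_of_le_of_ne hb fun h => ha.ne' (hab h.symm)
  exact ContinuousOn.div (by fun_prop) (by fun_prop) fun s hs => (convexCombination_pos ha hb hs).ne'

theorem intervalIntegrable_logKernel {a b : ℝ} (ha : 0 ≤ a) (hb : 0 ≤ b) (hab : b = 0 → a = 0) :
    IntervalIntegrable (logKernel a b) MeasureTheory.volume 0 1 :=
  (continuousOn_logKernel ha hb hab).intervalIntegrable_of_Icc zero_le_one

theorem integral_logKernel {a b : ℝ} (ha : 0 ≤ a) (hb : 0 ≤ b) (hab : b = 0 → a = 0) :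
    ∫ s in (0 : ℝ)..1, logKernel a b s = a * Real.log (a / b) := by
  rcases eq_or_lt_of_le ha with rfl | ha'
  · simp [logKernel]
  have hb' : 0 < b := lt_of_le_of_ne hb fun h => ha'.ne' (hab h.symm)
  rw [intervalIntegral.integral_eq_sub_of_hasDerivAt
    (f := fun s => a * Real.log ((1 - s) * b + s * a)) _ (intervalIntegrable_logKernel ha hb hab)]
  · simp only [sub_self, zero_mul, one_mul, zero_add, sub_zero, add_zero]
    rw [Real.log_div ha'.ne' hb'.ne']
    ring
  · intro s hs
    rw [Set.uIcc_of_le zero_le_one] at hs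
    have h1 : HasDerivAt (fun s : ℝ => (1 - s) * b + s * a) (a - b) s := by
      have := (((hasDerivAt_id s).const_sub 1).mul_const b).add ((hasDerivAt_id s).mul_const a)
      exact this.congr_deriv (by ring)
    have h2 := (h1.log (convexCombination_pos ha' hb' hs).ne').const_mul a
    rwa [← mul_div_assoc] at h2

/-- Up to a linear term, this exposes `a² / w`, which has a variational formula. -/
theorem one_sub_mul_logKernel {a b s : ℝ} (h : (1 - s) * b + s * a ≠ 0) :
    (1 - s) * logKernel a b s = a ^ 2 / ((1 - s) * b + s * a) - a := by
  rw [logKernel]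
  field_simp
  ring

/-! ### The quantum variational problem -/

/-- The maximizer of `Z ↦ 2 re tr (ρ Z) - (1 - s) tr (σ Z* Z) - s tr (ρ Z Z*)` over all matrices,
for `ρ = U diag(p) U*` and `σ = V diag(q) V*`. -/
noncomputable def optimizer (U V : Matrix n n ℂ) (p q : n → ℝ) (s : ℝ) : Matrix n n ℂ :=
  U * of (fun i j => ((p i / ((1 - s) * q j + s * p i) : ℝ) : ℂ) * (Uᴴ * V) i j) * Vᴴ

omit [DecidableEq n] in
theorem continuousOn_optimizer (U V : Matrix n n ℂ) {p q : n → ℝ} (hp : ∀ i, 0 < p i)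
    (hq : ∀ i, 0 < q i) (k l : n) :
    ContinuousOn (fun s => optimizer U V p q s k l) (Set.Icc 0 1) := by
  simp only [optimizer, mul_apply, of_apply]
  refine continuousOn_finsetSum _ fun j _ => ContinuousOn.mul ?_ continuousOn_const
  refine continuousOn_finsetSum _ fun i _ => ContinuousOn.mul continuousOn_const ?_
  refine ContinuousOn.mul ?_ continuousOn_const
  refine Complex.continuous_ofReal.comp_continuousOn ?_
  exact ContinuousOn.div (by fun_prop) (by fun_prop)
    fun s hs => (convexCombination_pos (hp i) (hq j) hs).ne'

omit [DecidableEq n] in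
/-- If `Z` is Hermitian, its Frobenius distance to `G` is bounded below by the
non-Hermitian part of `G`. -/
theorem normSq_sub_conjTranspose_le {Z : Matrix n n ℂ} (hZ : Z.IsHermitian) (G : Matrix n n ℂ)
    (k l : n) :
    Complex.normSq ((G - Gᴴ) k l) ≤ 4 * ∑ i, ∑ j, Complex.normSq ((Z - G) i j) := by
  have hle : ∀ i j, Complex.normSq ((Z - G) i j) ≤ ∑ i, ∑ j, Complex.normSq ((Z - G) i j) := by
    intro i j
    refine le_trans ?_ (Finset.single_le_sum (f := fun i => ∑ j, Complex.normSq ((Z - G) i j))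
      (fun i _ => Finset.sum_nonneg fun j _ => Complex.normSq_nonneg _) (Finset.mem_univ i))
    exact Finset.single_le_sum (f := fun j => Complex.normSq ((Z - G) i j))
      (fun j _ => Complex.normSq_nonneg _) (Finset.mem_univ j)
  have h : G - Gᴴ = (Z - G)ᴴ - (Z - G) := by
    rw [conjTranspose_sub, hZ.eq]
    abel
  rw [h, Matrix.sub_apply, conjTranspose_apply]
  have h1 := hle k l
  have h2 := hle l k
  revert h1 h2
  generalize (Z - G) k l = u
  generalize (Z - G) l k = v
  intro h1 h2
  simp only [Complex.normSq_apply, Complex.sub_re, Complex.sub_im, Complex.star_def,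
    Complex.conj_re, Complex.conj_im] at *
  -- Parallelogram law: `2|u|² + 2|v|² - |star v - u|² = |star v + u|²`, whose two squares are the
  -- hints.
  nlinarith [sq_nonneg (v.re + u.re), sq_nonneg (v.im - u.im)]

/-- Completing the square, one matrix element at a time. -/
theorem two_mul_re_sub_normSq {p w : ℝ} (hw : w ≠ 0) (u z : ℂ) :
    2 * (p * (z * star u).re) - w * Complex.normSq z =
      Complex.normSq u * (p ^ 2 / w) - w * Complex.normSq (z - ((p / w : ℝ) : ℂ) * u) := by
  obtain ⟨c, rfl⟩ : ∃ c, p = w * c := ⟨p / w, (mul_div_cancel₀ p hw).symm⟩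
  have h : (w * c) ^ 2 / w = w * c ^ 2 := by field_simp
  rw [h, mul_div_cancel_left₀ c hw]
  simp only [Complex.normSq_apply, Complex.sub_re, Complex.sub_im, Complex.mul_re,
    Complex.mul_im, Complex.ofReal_re, Complex.ofReal_im, Complex.star_def, Complex.conj_re, Complex.conj_im]
  ring

/-- The integrands of the classical and the quantum relative entropy, compared pointwise. The
difference does not depend on the measurement. -/
theorem sum_logKernel_add_le {X : Type*} [Fintype X] (M : POVM X n) {ρ σ U V : Matrix n n ℂ}
    {p q : n → ℝ} (hρ : ρ.PosDef) (hσ : σ.PosDef)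
    (hU : U * Uᴴ = 1) (hU' : Uᴴ * U = 1) (hV : V * Vᴴ = 1) (hV' : Vᴴ * V = 1)
    (hρU : ρ = U * diagonal (fun i => (p i : ℂ)) * Uᴴ)
    (hσV : σ = V * diagonal (fun i => (q i : ℂ)) * Vᴴ)
    {m : ℝ} (hm : 0 < m) (hp : ∀ i, m ≤ p i) (hq : ∀ i, m ≤ q i)
    {s : ℝ} (hs : s ∈ Set.Ico (0 : ℝ) 1) (k l : n) :
    ∑ x, logKernel (M.statistics ρ x) (M.statistics σ x) s +
      m / 4 * Complex.normSq ((optimizer U V p q s - (optimizer U V p q s)ᴴ) k l) ≤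
    ∑ i, ∑ j, Complex.normSq ((Uᴴ * V) i j) * logKernel (p i) (q j) s := by
  have hs1 : 0 < 1 - s := sub_pos.mpr hs.2
  set P := M.statistics ρ with hP
  set Q := M.statistics σ with hQ
  set w : n → n → ℝ := fun i j => (1 - s) * q j + s * p i with hw
  set G := optimizer U V p q s with hG
  have hmw : ∀ i j, m ≤ w i j := fun i j => by
    have h1 := mul_le_mul_of_nonneg_left (hq j) hs1.le
    have h2 := mul_le_mul_of_nonneg_left (hp i) hs.1
    simp only [hw]
    linarith
  have hw0 : ∀ i j, w i j ≠ 0 := fun i j => (hm.trans_le (hmw i j)).ne'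
  have hP0 : ∀ x, 0 ≤ P x := M.statistics_nonneg hρ.posSemidef
  have hQ0 : ∀ x, 0 ≤ Q x := M.statistics_nonneg hσ.posSemidef
  -- The classical maximizer; at an outcome with `P x = Q x = 0` division by zero gives the harmless
  -- value `0`.
  set z : X → ℝ := fun x => P x / ((1 - s) * Q x + s * P x) with hz
  set Z := M.operator z with hZ
  have hZh : Z.IsHermitian := M.isHermitian_operator z
  have hclass : ∀ x, (1 - s) * logKernel (P x) (Q x) s =
      2 * (z x * P x) - (1 - s) * (z x ^ 2 * Q x) - s * (z x ^ 2 * P x) - P x := by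
    intro x
    rcases eq_or_lt_of_le (hQ0 x) with h | h
    · have : P x = 0 := M.statistics_eq_zero hσ h.symm ρ
      simp [logKernel, this, ← h]
    · have hpos : (1 - s) * Q x + s * P x ≠ 0 :=
        (add_pos_of_pos_of_nonneg (mul_pos hs1 h) (mul_nonneg hs.1 (hP0 x))).ne'
      have hzd : z x * ((1 - s) * Q x + s * P x) = P x := div_mul_cancel₀ _ hpos
      have hsq : P x ^ 2 / ((1 - s) * Q x + s * P x) = z x * P x := by
        rw [pow_two, mul_div_right_comm]
      rw [one_sub_mul_logKernel hpos, hsq]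
      linear_combination z x * hzd
  -- Both sides are the trace of `ρ`, so the linear terms of the two integrands cancel. The constant
  -- `1` makes the second matrix the identity.
  have hPsum : ∑ x, P x = ∑ i, ∑ j, Complex.normSq ((Uᴴ * V) i j) * p i := by
    have h := re_trace_conj_mul_conj U V hV hV' p (fun _ => 1)
    have h1 : (diagonal fun _ => ((1 : ℝ) : ℂ) : Matrix n n ℂ) = 1 := by simp
    rw [h1, Matrix.mul_one, hV, Matrix.mul_one, ← hρU] at h
    rw [hP, M.sum_statistics, h]
    simp
  have hquant : ∀ i j, (1 - s) * (Complex.normSq ((Uᴴ * V) i j) * logKernel (p i) (q j) s) =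
      Complex.normSq ((Uᴴ * V) i j) * (p i ^ 2 / w i j) - Complex.normSq ((Uᴴ * V) i j) * p i := by
    intro i j
    rw [mul_left_comm, one_sub_mul_logKernel (hw0 i j)]
    ring
  have hZG : ∀ i j, (Uᴴ * (Z - G) * V) i j =
      (Uᴴ * Z * V) i j - ((p i / w i j : ℝ) : ℂ) * (Uᴴ * V) i j := by
    intro i j
    have : Uᴴ * G * V = of (fun i j => ((p i / w i j : ℝ) : ℂ) * (Uᴴ * V) i j) := by
      rw [hG, optimizer, ← Matrix.mul_assoc, ← Matrix.mul_assoc, hU', Matrix.one_mul,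
        Matrix.mul_assoc, hV', Matrix.mul_one]
    rw [Matrix.mul_sub, Matrix.sub_mul, this, Matrix.sub_apply, of_apply]
  have hgap : m * ∑ i, ∑ j, Complex.normSq ((Z - G) i j) ≤
      ∑ i, ∑ j, w i j * Complex.normSq ((Uᴴ * (Z - G) * V) i j) := by
    rw [← sum_normSq_conj U V _ hU hV]
    simp only [Finset.mul_sum]
    exact Finset.sum_le_sum fun i _ => Finset.sum_le_sum fun j _ =>
      mul_le_mul_of_nonneg_right (hmw i j) (Complex.normSq_nonneg _)
  have hdist := normSq_sub_conjTranspose_le hZh G k l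
  -- Kadison's inequality enters here, once for `σ` and once for `ρ`.
  have hC : ∑ x, (1 - s) * logKernel (P x) (Q x) s ≤
      2 * (trace (ρ * Z)).re - (1 - s) * (trace (σ * (Z * Z))).re
        - s * (trace (ρ * (Z * Z))).re - ∑ x, P x := by
    have h1 := mul_le_mul_of_nonneg_left
      (M.re_trace_mul_operator_sq_le hσ.posSemidef z) hs1.le
    have h2 := mul_le_mul_of_nonneg_left (M.re_trace_mul_operator_sq_le hρ.posSemidef z) hs.1
    rw [Finset.sum_congr rfl fun x _ => hclass x]
    simp only [Finset.sum_sub_distrib, ← Finset.mul_sum]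
    rw [hZ, M.re_trace_mul_operator]
    linarith
  have hquad : 2 * (trace (ρ * Z)).re - (1 - s) * (trace (σ * (Z * Z))).re
        - s * (trace (ρ * (Z * Z))).re =
      ∑ i, ∑ j, (Complex.normSq ((Uᴴ * V) i j) * (p i ^ 2 / w i j) -
        w i j * Complex.normSq ((Uᴴ * (Z - G) * V) i j)) := by
    rw [hρU, hσV, re_trace_conj_mul U V Z hV, re_trace_conj_mul_sq_left U V Z hV hZh,
      re_trace_conj_mul_sq_right U V Z hU hZh]
    simp only [Finset.mul_sum, ← Finset.sum_sub_distrib]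
    refine Finset.sum_congr rfl fun i _ => Finset.sum_congr rfl fun j _ => ?_
    rw [hZG, ← two_mul_re_sub_normSq (hw0 i j)]
    simp only [hw]
    ring
  have hF : (1 - s) * ∑ i, ∑ j, Complex.normSq ((Uᴴ * V) i j) * logKernel (p i) (q j) s =
      ∑ i, ∑ j, Complex.normSq ((Uᴴ * V) i j) * (p i ^ 2 / w i j) - ∑ x, P x := by
    rw [hPsum]
    simp only [Finset.mul_sum, hquant, Finset.sum_sub_distrib]
  rw [← Finset.mul_sum] at hC
  rw [hquad] at hC
  simp only [Finset.sum_sub_distrib] at hC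
  have hδ : 0 ≤ m / 4 * Complex.normSq ((G - Gᴴ) k l) :=
    mul_nonneg (by positivity) (Complex.normSq_nonneg _)
  have hmul : m / 4 * Complex.normSq ((G - Gᴴ) k l) ≤
      (1 - s) * (∑ i, ∑ j, Complex.normSq ((Uᴴ * V) i j) * logKernel (p i) (q j) s -
        ∑ x, logKernel (P x) (Q x) s) := by
    rw [mul_sub, hF]
    have := mul_le_mul_of_nonneg_left hdist hm.le
    linarith
  -- The factor `1 - s` can be dropped because the difference is nonnegative and `0 < 1 - s ≤ 1`.
  have hnn := nonneg_of_mul_nonneg_right (hδ.trans hmul) hs1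
  have := mul_le_of_le_one_left hnn (by linarith [hs.1] : 1 - s ≤ 1)
  linarith

/-! ### Integration and the uniform gap -/

theorem klDivergence_statistics {X : Type*} [Fintype X] (M : POVM X n) {σ : Matrix n n ℂ}
    (ρ : Matrix n n ℂ) (hσ : σ.PosDef) :
    klDivergence (M.statistics ρ) (M.statistics σ) =
      ((∑ x, M.statistics ρ x * Real.log (M.statistics ρ x / M.statistics σ x) : ℝ) : EReal) :=
  if_pos fun _ h => M.statistics_eq_zero hσ h ρ

theorem umegakiRelEntropy_of_posDef {σ : Matrix n n ℂ} (ρ : Matrix n n ℂ) (hσ : σ.PosDef) :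
    umegakiRelEntropy ρ σ =
      (((trace (ρ * (cfc Real.log ρ - cfc Real.log σ))).re : ℝ) : EReal) := by
  refine if_pos fun v hv => ?_
  have hv0 : v = 0 := by
    by_contra h
    have := hσ.dotProduct_mulVec_pos h
    rw [hv, dotProduct_zero] at this
    exact lt_irrefl _ this
  rw [hv0, mulVec_zero]

/-- At `s = 0` the coefficients are `p i / q j`, and multiplying by `σ` on the right cancels `q j`.
-/
theorem optimizer_zero_mul {U V : Matrix n n ℂ} (hV : V * Vᴴ = 1) (hV' : Vᴴ * V = 1)
    (p : n → ℝ) {q : n → ℝ} (hq : ∀ i, 0 < q i) :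
    optimizer U V p q 0 * (V * diagonal (fun i => (q i : ℂ)) * Vᴴ) =
      U * diagonal (fun i => (p i : ℂ)) * Uᴴ := by
  have h : of (fun i j => ((p i / ((1 - 0) * q j + 0 * p i) : ℝ) : ℂ) * (Uᴴ * V) i j) *
      diagonal (fun i => (q i : ℂ)) = diagonal (fun i => (p i : ℂ)) * (Uᴴ * V) := by
    ext i j
    have : (q j : ℂ) ≠ 0 := Complex.ofReal_ne_zero.mpr (hq j).ne'
    rw [mul_diagonal, diagonal_mul, of_apply, sub_zero, one_mul, zero_mul, add_zero,
      Complex.ofReal_div, mul_right_comm, div_mul_cancel₀ _ this]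
  calc optimizer U V p q 0 * (V * diagonal (fun i => (q i : ℂ)) * Vᴴ)
      = U * (of (fun i j => ((p i / ((1 - 0) * q j + 0 * p i) : ℝ) : ℂ) * (Uᴴ * V) i j) *
          ((Vᴴ * V) * diagonal (fun i => (q i : ℂ)))) * Vᴴ := by
        simp only [optimizer, Matrix.mul_assoc]
    _ = U * diagonal (fun i => (p i : ℂ)) * Uᴴ * (V * Vᴴ) := by
        rw [hV', Matrix.one_mul, h]
        simp only [Matrix.mul_assoc]
    _ = _ := by rw [hV, Matrix.mul_one]

/-- Umegaki's relative entropy is the classical relative entropy of the Nussbaum-Szkoła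
distributions. -/
theorem re_trace_mul_cfc_log_sub {ρ σ : Matrix n n ℂ} (hρ : ρ.IsHermitian) (hσ : σ.IsHermitian)
    (hp : ∀ i, 0 < hρ.eigenvalues i) (hq : ∀ i, 0 < hσ.eigenvalues i) :
    (trace (ρ * (cfc Real.log ρ - cfc Real.log σ))).re =
      ∑ i, ∑ j, Complex.normSq (((hρ.eigenvectorUnitary : Matrix n n ℂ)ᴴ *
        (hσ.eigenvectorUnitary : Matrix n n ℂ)) i j) *
        (hρ.eigenvalues i * Real.log (hρ.eigenvalues i / hσ.eigenvalues j)) := by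
  set U : Matrix n n ℂ := (hρ.eigenvectorUnitary : Matrix n n ℂ) with hUdef
  set V : Matrix n n ℂ := (hσ.eigenvectorUnitary : Matrix n n ℂ) with hVdef
  have hU' : Uᴴ * U = 1 := Unitary.coe_star_mul_self hρ.eigenvectorUnitary
  have hV : V * Vᴴ = 1 := Unitary.coe_mul_star_self hσ.eigenvectorUnitary
  have hV' : Vᴴ * V = 1 := Unitary.coe_star_mul_self hσ.eigenvectorUnitary
  -- Taking `1` as the second spectrum puts `tr (ρ log ρ)` in the same double-sum form as the cross
  -- term.
  have h1 := re_trace_conj_mul_conj U V hV hV'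
    (fun i => hρ.eigenvalues i * Real.log (hρ.eigenvalues i)) (fun _ => 1)
  have h2 := re_trace_conj_mul_conj U V hV hV' hρ.eigenvalues
    (fun i => Real.log (hσ.eigenvalues i))
  have hone : (diagonal fun _ => ((1 : ℝ) : ℂ) : Matrix n n ℂ) = 1 := by simp
  rw [hone, Matrix.mul_one, hV, Matrix.mul_one] at h1
  rw [← hρ.eq_mul_diagonal_mul, ← hσ.cfc_eq_mul_diagonal_mul Real.log] at h2
  have h3 : ρ * cfc Real.log ρ = U * diagonal (fun i =>
      ((hρ.eigenvalues i * Real.log (hρ.eigenvalues i) : ℝ) : ℂ)) * Uᴴ := by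
    rw [hρ.cfc_eq_mul_diagonal_mul]
    conv_lhs => enter [1]; rw [hρ.eq_mul_diagonal_mul]
    rw [← hUdef]
    have : (diagonal fun i => ((hρ.eigenvalues i * Real.log (hρ.eigenvalues i) : ℝ) : ℂ)) =
        diagonal (fun i => (hρ.eigenvalues i : ℂ)) * (Uᴴ * U) *
          diagonal (fun i => ((Real.log (hρ.eigenvalues i) : ℝ) : ℂ)) := by
      rw [hU', Matrix.mul_one, diagonal_mul_diagonal]
      simp only [Complex.ofReal_mul]
    rw [this]
    simp only [Matrix.mul_assoc]
  rw [mul_sub, trace_sub, Complex.sub_re, h3, h1, h2]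
  simp only [← Finset.sum_sub_distrib]
  refine Finset.sum_congr rfl fun i _ => Finset.sum_congr rfl fun j _ => ?_
  rw [Real.log_div (hp i).ne' (hq j).ne']
  ring

/-- A lower bound on the gap between the measured and the Umegaki relative entropy that holds
uniformly in the measurement. -/
theorem exists_measuredRelEntropy_le {ρ σ : Matrix n n ℂ} [Nonempty n] (hρ : ρ.PosDef)
    (hσ : σ.PosDef) :
    ∃ ε : ℝ, 0 ≤ ε ∧ (⁅ρ, σ⁆ ≠ 0 → 0 < ε) ∧ measuredRelEntropy ρ σ ≤
      (((trace (ρ * (cfc Real.log ρ - cfc Real.log σ))).re - ε : ℝ) : EReal) := by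
  set U : Matrix n n ℂ := (hρ.1.eigenvectorUnitary : Matrix n n ℂ) with hUdef
  set V : Matrix n n ℂ := (hσ.1.eigenvectorUnitary : Matrix n n ℂ) with hVdef
  set p := hρ.1.eigenvalues with hpdef
  set q := hσ.1.eigenvalues with hqdef
  have hU : U * Uᴴ = 1 := Unitary.coe_mul_star_self hρ.1.eigenvectorUnitary
  have hU' : Uᴴ * U = 1 := Unitary.coe_star_mul_self hρ.1.eigenvectorUnitary
  have hV : V * Vᴴ = 1 := Unitary.coe_mul_star_self hσ.1.eigenvectorUnitary
  have hV' : Vᴴ * V = 1 := Unitary.coe_star_mul_self hσ.1.eigenvectorUnitary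
  have hρU : ρ = U * diagonal (fun i => (p i : ℂ)) * Uᴴ := hρ.1.eq_mul_diagonal_mul
  have hσV : σ = V * diagonal (fun i => (q i : ℂ)) * Vᴴ := hσ.1.eq_mul_diagonal_mul
  have hp0 : ∀ i, 0 < p i := hρ.eigenvalues_pos
  have hq0 : ∀ i, 0 < q i := hσ.eigenvalues_pos
  obtain ⟨m, hm, hp, hq⟩ : ∃ m : ℝ, 0 < m ∧ (∀ i, m ≤ p i) ∧ ∀ i, m ≤ q i := by
    obtain ⟨i, hi⟩ := Finite.exists_min p
    obtain ⟨j, hj⟩ := Finite.exists_min q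
    exact ⟨min (p i) (q j), lt_min (hp0 i) (hq0 j), fun a => (min_le_left _ _).trans (hi a),
      fun a => (min_le_right _ _).trans (hj a)⟩
  set G := optimizer U V p q with hG
  -- One entry of the non-Hermitian part is fixed for all `s` and all measurements. If there is no
  -- nonzero entry at `s = 0`, then `ρ = G 0 * σ = σ * G 0`, hence `ρ * σ = σ * G 0 * σ = σ * ρ`.
  obtain ⟨k, l, hkl⟩ : ∃ k l, ⁅ρ, σ⁆ ≠ 0 → (G 0 - (G 0)ᴴ) k l ≠ 0 := by
    by_cases h : ∃ k l, (G 0 - (G 0)ᴴ) k l ≠ 0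
    · obtain ⟨k, l, h⟩ := h
      exact ⟨k, l, fun _ => h⟩
    · push Not at h
      have hGh : (G 0)ᴴ = G 0 := by
        ext i j
        have := h i j
        rw [Matrix.sub_apply, sub_eq_zero] at this
        exact this.symm
      have h1 : G 0 * σ = ρ := by
        rw [hσV, hG, optimizer_zero_mul hV hV' p hq0, ← hρU]
      have h2 : σ * G 0 = ρ := by
        have := congrArg conjTranspose h1
        rwa [conjTranspose_mul, hGh, hσ.1.eq, hρ.1.eq] at this
      obtain ⟨i⟩ := ‹Nonempty n›
      refine ⟨i, i, fun hne => absurd ?_ hne⟩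
      rw [Ring.lie_def, sub_eq_zero]
      calc ρ * σ = σ * G 0 * σ := by rw [h2]
        _ = σ * ρ := by rw [Matrix.mul_assoc, h1]
  set δ : ℝ → ℝ := fun s => m / 4 * Complex.normSq ((G s - (G s)ᴴ) k l) with hδ
  have hδc : ContinuousOn δ (Set.Icc 0 1) := by
    refine ContinuousOn.mul continuousOn_const (Complex.continuous_normSq.comp_continuousOn ?_)
    simp only [Matrix.sub_apply, conjTranspose_apply]
    exact (continuousOn_optimizer U V hp0 hq0 k l).sub
      (continuous_star.comp_continuousOn (continuousOn_optimizer U V hp0 hq0 l k))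
  have hδ0 : ∀ s, 0 ≤ δ s := fun s => mul_nonneg (by positivity) (Complex.normSq_nonneg _)
  have hδi : IntervalIntegrable δ MeasureTheory.volume 0 1 :=
    hδc.intervalIntegrable_of_Icc zero_le_one
  refine ⟨∫ s in (0 : ℝ)..1, δ s, intervalIntegral.integral_nonneg zero_le_one fun s _ => hδ0 s,
    fun hne => ?_, ?_⟩
  · have := intervalIntegral.integral_lt_integral_of_continuousOn_of_le_of_exists_lt
      (f := fun _ => (0 : ℝ)) zero_lt_one continuousOn_const hδc (fun s _ => hδ0 s)
      ⟨0, by simp, mul_pos (by positivity) (Complex.normSq_pos.mpr (hkl hne))⟩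
    simpa using this
  · refine iSup_le fun X => iSup_le fun _ => iSup_le fun M => ?_
    rw [klDivergence_statistics M ρ hσ, EReal.coe_le_coe_iff, le_sub_iff_add_le,
      re_trace_mul_cfc_log_sub hρ.1 hσ.1 hp0 hq0]
    have hMn := fun x => M.statistics_nonneg hρ.posSemidef x
    have hMn' := fun x => M.statistics_nonneg hσ.posSemidef x
    have hMz := fun x (h : M.statistics σ x = 0) => M.statistics_eq_zero hσ h ρ
    have hcl : ∀ x ∈ Finset.univ, IntervalIntegrable
        (fun s => logKernel (M.statistics ρ x) (M.statistics σ x) s) MeasureTheory.volume 0 1 :=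
      fun x _ => intervalIntegrable_logKernel (hMn x) (hMn' x) (hMz x)
    have hqu : ∀ i j, IntervalIntegrable (fun s => Complex.normSq ((Uᴴ * V) i j) *
        logKernel (p i) (q j) s) MeasureTheory.volume 0 1 := fun i j =>
      (intervalIntegrable_logKernel (hp0 i).le (hq0 j).le
        fun h => absurd h (hq0 j).ne').const_mul _
    have hqu' : ∀ i ∈ Finset.univ, IntervalIntegrable (fun s => ∑ j,
        Complex.normSq ((Uᴴ * V) i j) * logKernel (p i) (q j) s) MeasureTheory.volume 0 1 :=
      fun i _ => by
        simpa only [Finset.sum_fn] using IntervalIntegrable.sum Finset.univ fun j _ => hqu i j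
    have hcl' : IntervalIntegrable (fun s => ∑ x, logKernel (M.statistics ρ x)
        (M.statistics σ x) s) MeasureTheory.volume 0 1 := by
      simpa only [Finset.sum_fn] using IntervalIntegrable.sum Finset.univ hcl
    have hqu'' : IntervalIntegrable (fun s => ∑ i, ∑ j, Complex.normSq ((Uᴴ * V) i j) *
        logKernel (p i) (q j) s) MeasureTheory.volume 0 1 := by
      simpa only [Finset.sum_fn] using IntervalIntegrable.sum Finset.univ hqu'
    -- The pointwise comparison excludes `s = 1`, so it is used on the open interval only.
    have hmono := intervalIntegral.integral_mono_on_of_le_Ioo zero_le_one (hcl'.add hδi) hqu''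
      fun s hs => sum_logKernel_add_le M hρ hσ hU hU' hV hV' hρU hσV hm hp hq
        ⟨hs.1.le, hs.2⟩ k l
    rw [intervalIntegral.integral_add hcl' hδi, intervalIntegral.integral_finsetSum hcl,
      intervalIntegral.integral_finsetSum hqu'] at hmono
    convert hmono using 3 with x _ i
    · rw [integral_logKernel (hMn x) (hMn' x) (hMz x)]
    · rw [intervalIntegral.integral_finsetSum fun j _ => hqu i j]
      refine Finset.sum_congr rfl fun j _ => ?_
      rw [intervalIntegral.integral_const_mul, integral_logKernel (hp0 i).le (hq0 j).le
        fun h => absurd h (hq0 j).ne']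

/-! ### Commuting states -/

/-- The spectral projection of `A` onto the eigenspace of `a`. -/
noncomputable def spectralProjection (A : Matrix n n ℂ) (a : ℝ) : Matrix n n ℂ :=
  cfc (Pi.single a (1 : ℝ)) A

/-- The spectrum is finite, so the functional calculus applies even to indicators of points. -/
theorem continuousOn_spectrum (A : Matrix n n ℂ) (f : ℝ → ℝ) : ContinuousOn f (spectrum ℝ A) :=
  Matrix.finite_real_spectrum.continuousOn f

theorem isHermitian_spectralProjection (A : Matrix n n ℂ) (a : ℝ) :
    (spectralProjection A a).IsHermitian :=
  cfc_predicate (p := IsSelfAdjoint) _ A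

theorem spectralProjection_mul_self (A : Matrix n n ℂ) (a : ℝ) :
    spectralProjection A a * spectralProjection A a = spectralProjection A a := by
  rw [spectralProjection, ← cfc_mul _ _ A (continuousOn_spectrum A _) (continuousOn_spectrum A _)]
  congr 1
  ext x
  by_cases h : x = a <;> simp [h]

theorem spectralProjection_mul_cfc (A : Matrix n n ℂ) (a : ℝ) (f : ℝ → ℝ) :
    spectralProjection A a * cfc f A = (f a : ℂ) • spectralProjection A a := by
  rw [spectralProjection, ← cfc_mul _ _ A (continuousOn_spectrum A _) (continuousOn_spectrum A _),
    Complex.coe_smul, ← cfc_smul _ _ A (continuousOn_spectrum A _)]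
  congr 1
  ext x
  by_cases h : x = a <;> simp [h]

theorem sum_spectralProjection {A : Matrix n n ℂ} (hA : A.IsHermitian) {S : Finset ℝ}
    (hS : spectrum ℝ A ⊆ S) : ∑ a ∈ S, spectralProjection A a = 1 := by
  have hA' : IsSelfAdjoint A := hA
  simp only [spectralProjection]
  rw [← cfc_sum _ A S fun _ _ => continuousOn_spectrum A _, ← cfc_one ℝ A hA']
  refine cfc_congr fun x hx => ?_
  have hxS : x ∈ S := hS hx
  simp [Finset.sum_apply, Pi.single_apply, hxS]

/-- If `ρ` and `σ` commute, measuring their joint spectral decomposition loses no information. -/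
theorem umegakiRelEntropy_le_of_commute {ρ σ : Matrix n n ℂ} (hρ : ρ.PosDef) (hσ : σ.PosDef)
    (h : Commute ρ σ) : umegakiRelEntropy ρ σ ≤ measuredRelEntropy ρ σ := by
  set S := (Matrix.finite_real_spectrum (A := ρ)).toFinset with hS
  set T := (Matrix.finite_real_spectrum (A := σ)).toFinset with hT
  set E := spectralProjection ρ with hE
  set F := spectralProjection σ with hF
  have hρ' : IsSelfAdjoint ρ := hρ.1
  have hσ' : IsSelfAdjoint σ := hσ.1
  have hES : ∑ a : S, E a = 1 := by
    rw [Finset.sum_coe_sort S]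
    exact sum_spectralProjection hρ.1 (by simp [hS])
  have hFT : ∑ b : T, F b = 1 := by
    rw [Finset.sum_coe_sort T]
    exact sum_spectralProjection hσ.1 (by simp [hT])
  have hEF : ∀ a b, Commute (E a) (F b) := fun a b => (((h.cfc_real _).symm).cfc_real _).symm
  have hE' : ∀ (f : ℝ → ℝ) a, E a * cfc f ρ = (f a : ℂ) • E a := fun f a => spectralProjection_mul_cfc ρ a f
  have hF' : ∀ (f : ℝ → ℝ) b, F b * cfc f σ = (f b : ℂ) • F b := fun f b => spectralProjection_mul_cfc σ b f
  have hEFρ : ∀ (f : ℝ → ℝ) a b, E a * F b * cfc f ρ = (f a : ℂ) • (E a * F b) := fun f a b => by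
    rw [(hEF a b).eq, mul_assoc, hE', mul_smul_comm]
  have hEFσ : ∀ (f : ℝ → ℝ) a b, E a * F b * cfc f σ = (f b : ℂ) • (E a * F b) := fun f a b => by
    rw [mul_assoc, hF', mul_smul_comm]
  let M : POVM (S × T) n :=
    { effect := fun x => E x.1 * F x.2
      posSemidef := fun x => by
        -- The product of commuting orthogonal projections is an orthogonal projection.
        have h1 : E x.1 * F x.2 = (E x.1 * F x.2)ᴴ * (E x.1 * F x.2) := by
          rw [conjTranspose_mul, (isHermitian_spectralProjection ρ _).eq,
            (isHermitian_spectralProjection σ _).eq, ← (hEF x.1 x.2).eq, Matrix.mul_assoc,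
            ← Matrix.mul_assoc (F _), ← (hEF x.1 x.2).eq, Matrix.mul_assoc, ← Matrix.mul_assoc,
            spectralProjection_mul_self, spectralProjection_mul_self]
        rw [h1]
        exact posSemidef_conjTranspose_mul_self _
      sum_eq_one := by
        rw [Fintype.sum_prod_type]
        simp only [← Finset.mul_sum, hFT, mul_one, hES] }
  have hMρ : ∀ x, M.statistics ρ x = x.1 * (trace (E x.1 * F x.2)).re := fun x => by
    have := hEFρ id x.1 x.2
    rw [cfc_id ℝ ρ hρ'] at this
    change (trace (E x.1 * F x.2 * ρ)).re = _
    rw [this, trace_smul, smul_eq_mul, Complex.re_ofReal_mul]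
    rfl
  have hMσ : ∀ x, M.statistics σ x = x.2 * (trace (E x.1 * F x.2)).re := fun x => by
    have := hEFσ id x.1 x.2
    rw [cfc_id ℝ σ hσ'] at this
    change (trace (E x.1 * F x.2 * σ)).re = _
    rw [this, trace_smul, smul_eq_mul, Complex.re_ofReal_mul]
    rfl
  have hSpos : ∀ a : S, 0 < (a : ℝ) := fun a => by
    have := (Set.Finite.mem_toFinset _).mp a.2
    rw [hρ.1.spectrum_real_eq_range_eigenvalues] at this
    obtain ⟨i, hi⟩ := this
    exact hi ▸ hρ.eigenvalues_pos i
  have hTpos : ∀ b : T, 0 < (b : ℝ) := fun b => by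
    have := (Set.Finite.mem_toFinset _).mp b.2
    rw [hσ.1.spectrum_real_eq_range_eigenvalues] at this
    obtain ⟨i, hi⟩ := this
    exact hi ▸ hσ.eigenvalues_pos i
  have hD : (trace (ρ * (cfc Real.log ρ - cfc Real.log σ))).re =
      ∑ x, M.statistics ρ x * Real.log (M.statistics ρ x / M.statistics σ x) := by
    have h1 : ρ * (cfc Real.log ρ - cfc Real.log σ) =
        ∑ x, M.effect x * (ρ * (cfc Real.log ρ - cfc Real.log σ)) := by
      rw [← Finset.sum_mul, M.sum_eq_one, one_mul]
    rw [h1, trace_sum, Complex.re_sum]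
    refine Finset.sum_congr rfl fun x _ => ?_
    have h2 : M.effect x * (ρ * (cfc Real.log ρ - cfc Real.log σ)) =
        ((x.1 * (Real.log x.1 - Real.log x.2) : ℝ) : ℂ) • (E x.1 * F x.2) := by
      have := hEFρ id x.1 x.2
      rw [cfc_id ℝ ρ hρ'] at this
      change E x.1 * F x.2 * _ = _
      rw [← mul_assoc, this, smul_mul_assoc, mul_sub, hEFρ, hEFσ, ← sub_smul, smul_smul]
      push_cast
      rfl
    rw [h2, trace_smul, smul_eq_mul, Complex.re_ofReal_mul, hMρ, hMσ]
    -- Both statistics are an eigenvalue times this trace: if it vanishes the summand is zero,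
    -- otherwise it cancels in the ratio.
    rcases eq_or_ne (trace (E x.1 * F x.2)).re 0 with h0 | h0
    · simp [h0]
    · rw [mul_div_mul_right _ _ h0, Real.log_div (hSpos _).ne' (hTpos _).ne']
      ring
  rw [umegakiRelEntropy_of_posDef ρ hσ, hD, ← klDivergence_statistics M ρ hσ]
  exact le_iSup_of_le (S × T) (le_iSup_of_le inferInstance (le_iSup_of_le M le_rfl))

end QuantumEntropy

theorem proposition5 {n : Type*} [Fintype n] [DecidableEq n] (ρ σ : Matrix n n ℂ)
    (hρ : ρ.PosDef) (hρ_tr : ρ.trace = 1) (hσ : σ.PosDef) :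
    QuantumEntropy.measuredRelEntropy ρ σ ≤ QuantumEntropy.umegakiRelEntropy ρ σ ∧
      (QuantumEntropy.measuredRelEntropy ρ σ = QuantumEntropy.umegakiRelEntropy ρ σ ↔
        ⁅ρ, σ⁆ = 0) := by
  -- On the zero space the trace would be `0`, not `1`.
  have hn : Nonempty n := by
    by_contra h
    rw [not_nonempty_iff] at h
    simp [Matrix.trace] at hρ_tr
  obtain ⟨ε, hε, hpos, hle⟩ := QuantumEntropy.exists_measuredRelEntropy_le hρ hσ
  have hmain : QuantumEntropy.measuredRelEntropy ρ σ ≤ QuantumEntropy.umegakiRelEntropy ρ σ := by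
    rw [QuantumEntropy.umegakiRelEntropy_of_posDef ρ hσ]
    exact hle.trans (EReal.coe_le_coe_iff.mpr (sub_le_self _ hε))
  refine ⟨hmain, fun h => ?_, fun h => hmain.antisymm
    (QuantumEntropy.umegakiRelEntropy_le_of_commute hρ hσ ?_)⟩
  · by_contra hne
    rw [h, QuantumEntropy.umegakiRelEntropy_of_posDef ρ hσ, EReal.coe_le_coe_iff] at hle
    linarith [hpos hne]
  · rwa [Ring.lie_def, sub_eq_zero] at h
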